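/- Let $K$ be a field, let $n\ge 3$ and $d\ge 1$, let $R=K[x_1,\dots,x_n]$ with the standard grading, and let $I\subseteq R$ be a homogeneous ideal such that $A=R/I$ is Artinian. The Betti table of $A$ has in row $j$ and column $i$ the graded Betti number $\beta_{i,i+j}$, the number of summands $R(-i-j)$ in the $i$-th module of the minimal graded free resolution of $A$ over $R$. Suppose that the Betti table of $A$ has a (maximal) $(n,d)$-Koszul tail, i.e. in the block of rows $0,\dots,d$ and columns $0,\dots,n$, row $0$ is $(1,0,\dots,0)$, rows $1,\dots,d-1$ are zero, and row $d$ is $\left(0,\,n,\,\binom n2,\,\binom n3,\dots,\binom n{n-2},\,n,\,1\right)$. Then $A$ does not have the Weak Lefschetz Property, that is, it is not true that multiplication by a general linear form $l$ gives maps $A_i\to A_{i+1}$ of full rank (injective or surjective) for all $i\ge 0$. More precisely, for every linear form $l\in R_1$, in particular for a general one, the multiplication map $\cdot l\colon A_d\to A_{d+1}$ is neither injective nor surjective. Moreover, there is a form $f\in R$ of degree $d$ with $I_{d+1}=f\cdot R_1$, that is, $I_{d+1}$ is the degree $d+1$ part of $f\cdot(x_1,\dots,x_n)$. -/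

import Mathlib

open MvPolynomial

attribute [local instance] MvPolynomial.gradedAlgebra

/-- The graded piece `A_i` of `A = K[x_1,…,x_n]/I`: the classes of the forms of degree `i`. -/
noncomputable def gradedPiece {K : Type*} [Field K] {n : ℕ}
    (I : Ideal (MvPolynomial (Fin n) K)) (i : ℕ) : Submodule K (MvPolynomial (Fin n) K ⧸ I) :=
  (homogeneousSubmodule (Fin n) K i).map (Ideal.Quotient.mkₐ K I).toLinearMap

/-- The linear form `a_1 x_1 + ⋯ + a_n x_n`. -/
noncomputable def linearForm {K : Type*} [Field K] {n : ℕ} (a : Fin n → K) :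
    MvPolynomial (Fin n) K :=
  ∑ t, C (a t) * X t

theorem linearForm_isHomogeneous {K : Type*} [Field K] {n : ℕ} (a : Fin n → K) :
    (linearForm a).IsHomogeneous 1 :=
  IsHomogeneous.sum _ _ _ fun t _ => by
    simpa using (isHomogeneous_C (Fin n) (a t)).mul (isHomogeneous_X K t)

theorem mul_mem_gradedPiece {K : Type*} [Field K] {n : ℕ}
    (I : Ideal (MvPolynomial (Fin n) K)) (a : Fin n → K) (i : ℕ)
    (y : MvPolynomial (Fin n) K ⧸ I) (hy : y ∈ gradedPiece I i) :
    LinearMap.mulLeft K (Ideal.Quotient.mk I (linearForm a)) y ∈ gradedPiece I (i + 1) := by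
  obtain ⟨p, hp, rfl⟩ := hy
  refine ⟨linearForm a * p, ?_, ?_⟩
  · have h := (linearForm_isHomogeneous a).mul ((mem_homogeneousSubmodule i p).1 hp)
    rw [add_comm] at h
    exact (mem_homogeneousSubmodule (i + 1) _).2 h
  · simp

/-- Multiplication by the linear form `l = a_1 x_1 + ⋯ + a_n x_n`, as a map `A_i → A_{i+1}`. -/
noncomputable def mulLinearForm {K : Type*} [Field K] {n : ℕ}
    (I : Ideal (MvPolynomial (Fin n) K)) (a : Fin n → K) (i : ℕ) :
    gradedPiece I i →ₗ[K] gradedPiece I (i + 1) :=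
  (LinearMap.mulLeft K (Ideal.Quotient.mk I (linearForm a))).restrict
    (mul_mem_gradedPiece I a i)

/-- A linear map has full rank: it is injective or surjective. -/
def IsFullRank {K V W : Type*} [Field K] [AddCommGroup V] [Module K V] [AddCommGroup W]
    [Module K W] (φ : V →ₗ[K] W) : Prop :=
  Function.Injective φ ∨ Function.Surjective φ

/-- A property of linear forms holds for a general linear form: it holds for all coefficient
vectors in some nonempty (principal) Zariski open subset of `K^n`. -/
def HoldsForGeneralLinearForm {K : Type*} [Field K] {n : ℕ} (Q : (Fin n → K) → Prop) : Prop :=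
  ∃ P : MvPolynomial (Fin n) K, (∃ a, eval a P ≠ 0) ∧ ∀ a, eval a P ≠ 0 → Q a

/-- The Weak Lefschetz Property of `K[x_1,…,x_n]/I`. -/
def HasWLP {K : Type*} [Field K] {n : ℕ} (I : Ideal (MvPolynomial (Fin n) K)) : Prop :=
  HoldsForGeneralLinearForm fun a : Fin n → K => ∀ i : ℕ, IsFullRank (mulLinearForm I a i)

/-- `v` is homogeneous of degree `m` in the graded free module `⨁ₜ R(-a t)`, in which the `t`-th
basis vector has degree `a t`. The zero vector is homogeneous of every degree. -/
def IsHomogeneousVector {K : Type*} [Field K] {n r : ℕ} (a : Fin r → ℕ) (m : ℕ)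
    (v : Fin r → MvPolynomial (Fin n) K) : Prop :=
  ∀ t, ∀ s ∈ (v t).support, s.degree + a t = m

/-- A minimal graded free resolution
`⋯ → F_2 → F_1 → F_0 → R/I → 0` over `R = K[x_1,…,x_n]`, where
`F_i = ⨁ₜ R(-shift i t)` has finite rank `rank i` and all maps are homogeneous of degree `0`. -/
structure MinimalGradedFreeResolution {K : Type*} [Field K] {n : ℕ}
    (I : Ideal (MvPolynomial (Fin n) K)) where
  /-- the rank of `F_i` -/
  rank : ℕ → ℕ
  /-- the degrees of the basis vectors of `F_i` -/
  shift : ∀ i, Fin (rank i) → ℕ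
  /-- the differential `F_{i+1} → F_i` -/
  d : ∀ i, (Fin (rank (i + 1)) → MvPolynomial (Fin n) K) →ₗ[MvPolynomial (Fin n) K]
    (Fin (rank i) → MvPolynomial (Fin n) K)
  /-- the augmentation `F_0 → R/I` -/
  aug : (Fin (rank 0) → MvPolynomial (Fin n) K) →ₗ[MvPolynomial (Fin n) K]
    (MvPolynomial (Fin n) K ⧸ I)
  d_homogeneous : ∀ i m v, IsHomogeneousVector (shift (i + 1)) m v →
    IsHomogeneousVector (shift i) m (d i v)
  aug_homogeneous : ∀ m v, IsHomogeneousVector (shift 0) m v → aug v ∈ gradedPiece I m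
  aug_surjective : Function.Surjective aug
  exact_zero : LinearMap.range (d 0) = LinearMap.ker aug
  exact_succ : ∀ i, LinearMap.range (d (i + 1)) = LinearMap.ker (d i)
  /-- minimality: the image of `F_{i+1}` lies in `(x_1,…,x_n) F_i` -/
  minimal : ∀ i v t, d i v t ∈ Ideal.span (Set.range (X : Fin n → MvPolynomial (Fin n) K))

/-- The graded Betti number `β_{i,j}`: the number of summands `R(-j)` of `F_i`. -/
def MinimalGradedFreeResolution.betti {K : Type*} [Field K] {n : ℕ}
    {I : Ideal (MvPolynomial (Fin n) K)} (F : MinimalGradedFreeResolution I) (i j : ℕ) : ℕ :=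
  (Finset.univ.filter fun t : Fin (F.rank i) => F.shift i t = j).card

/-- The Betti table: the entry in row `j` and column `i` is `β_{i,i+j}`. -/
def MinimalGradedFreeResolution.bettiTable {K : Type*} [Field K] {n : ℕ}
    {I : Ideal (MvPolynomial (Fin n) K)} (F : MinimalGradedFreeResolution I) (j i : ℕ) : ℕ :=
  F.betti i (i + j)

/-- The table `B` (first argument: row, second argument: column) has an `(n,d)`-Koszul tail: in
rows `0,…,d` and columns `0,…,n`, row `0` is `1, 0, …, 0`, rows `1,…,d-1` vanish, and row `d` is
`0, n, n.choose 2, …, n, 1`. -/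
structure HasKoszulTail (n d : ℕ) (B : ℕ → ℕ → ℕ) : Prop where
  pos : 1 ≤ d
  row_zero_left : B 0 0 = 1
  row_zero : ∀ i, 1 ≤ i → i ≤ n → B 0 i = 0
  row_mid : ∀ j, 1 ≤ j → j < d → ∀ i, i ≤ n → B j i = 0
  row_last_left : B d 0 = 0
  row_last : ∀ i, 1 ≤ i → i ≤ n → B d i = n.choose i

/-!
The proof rests on `β_{n,n+d} = dim_K Tor_n(A, K)_{n+d}`, which is the dimension of the degree `d`
part of the socle of `A = R/I`. The part of this that is needed is carried out along the
resolution `F`, with `J_k = (x_0, …, x_{k-1})`. Starting from a basis vector `u_n ∈ F_n` of degree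
`n + d`, whose differential lies in `J_n F_{n-1}` by minimality, one divides by one variable at a
time: `d u_{k+1} ≡ x_k u_k` modulo `J_k F_k`. This is the chain of connecting homomorphisms
`Tor_{k+1}(A, R/J_{k+1}) → Tor_k(A, R/J_k)`; these are `R`-linear, and injective because
`Tor_{k+1}(A, R/J_k) = 0` (`mem_sup_range_of_d_mem`). Hence `u_n ∉ J_n F_n` and
`x_i u_n ∈ J_n F_n` turn into: the class of `u_0 ∈ F_0` in `A` is nonzero and killed by every
`x_i` (`exists_socle_vector`). Since `F_0` has a single basis vector of degree at most `d`, this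
class is that of a form `f ∉ I` of degree `d` with `f · (x_0, …, x_{n-1}) ⊆ I`
(`exists_socle_form`).

Since `β_{1,d+1} = n` and `F_1` has no basis vectors of degree `1, …, d`, the space `I_{d+1}` is
contained in the span of `n` elements (`exists_finset_span`); it contains the `n`-dimensional space
`f R_1`, so the two are equal (`mem_of_homogeneous_iff`).

Multiplication by any linear form `l` kills the class of `f` in `A_d`, so it is not injective. If
it were surjective onto `A_{d+1}`, every form of degree `d + 1` would lie in `l R + f R`. A linear
substitution that kills `l` and fixes two of the variables, `x_i` and `x_j`, then makes the image
of `f` a common divisor of `x_i^{d+1}` and `x_j^{d+1}`, so a unit, although it is homogeneous of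
positive degree (`exists_X_pow_ne`).
-/

/-! ### Ideals generated by initial segments of the variables -/

/-- The ideal `J_k` generated by the first `k` variables. -/
noncomputable def initialVarIdeal (K : Type*) [Field K] (n k : ℕ) :
    Ideal (MvPolynomial (Fin n) K) :=
  Ideal.span (X '' {i : Fin n | i.1 < k})

theorem mem_initialVarIdeal {K : Type*} [Field K] {n k : ℕ} {p : MvPolynomial (Fin n) K} :
    p ∈ initialVarIdeal K n k ↔ ∀ m ∈ p.support, ∃ i : Fin n, i.1 < k ∧ m i ≠ 0 :=
  mem_ideal_span_X_image

theorem initialVarIdeal_zero (K : Type*) [Field K] (n : ℕ) : initialVarIdeal K n 0 = ⊥ := by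
  simp [initialVarIdeal]

theorem initialVarIdeal_self (K : Type*) [Field K] (n : ℕ) :
    initialVarIdeal K n n = Ideal.span (Set.range X) := by
  simp [initialVarIdeal]

theorem initialVarIdeal_mono (K : Type*) [Field K] (n : ℕ) {k l : ℕ} (h : k ≤ l) :
    initialVarIdeal K n k ≤ initialVarIdeal K n l :=
  Ideal.span_mono (Set.image_mono fun _ hi => lt_of_lt_of_le hi h)

theorem X_mem_initialVarIdeal {K : Type*} [Field K] {n k : ℕ} (i : Fin n) (hi : i.1 < k) :
    (X i : MvPolynomial (Fin n) K) ∈ initialVarIdeal K n k :=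
  Ideal.subset_span ⟨i, hi, rfl⟩

theorem mem_initialVarIdeal_of_X_mul_mem {K : Type*} [Field K] {n : ℕ} (k : Fin n)
    {p : MvPolynomial (Fin n) K} (h : X k * p ∈ initialVarIdeal K n k) :
    p ∈ initialVarIdeal K n k := by
  rw [mem_initialVarIdeal] at h ⊢
  intro m hm
  obtain ⟨i, hi, hmi⟩ := h (Finsupp.single k 1 + m) (by
    rw [support_X_mul]
    exact Finset.mem_map.2 ⟨m, hm, rfl⟩)
  refine ⟨i, hi, ?_⟩
  have hki : k ≠ i := fun e => by subst e; exact lt_irrefl _ hi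
  simpa [Finsupp.single_apply, hki] using hmi

theorem sub_X_mul_divMonomial_mem {K : Type*} [Field K] {n : ℕ} (k : Fin n)
    {p : MvPolynomial (Fin n) K} (h : p ∈ initialVarIdeal K n (k + 1)) :
    p - X k * p.divMonomial (Finsupp.single k 1) ∈ initialVarIdeal K n k := by
  have e : p - X k * p.divMonomial (Finsupp.single k 1) = p.modMonomial (Finsupp.single k 1) := by
    conv_lhs => enter [1]; rw [← modMonomial_add_divMonomial_single p k]
    ring
  rw [e, mem_initialVarIdeal]
  rw [mem_initialVarIdeal] at h
  intro m hm
  rw [mem_support_iff] at hm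
  have hle : ¬ Finsupp.single k 1 ≤ m := fun hle => hm (coeff_modMonomial_of_le p hle)
  rw [coeff_modMonomial_of_not_le p hle] at hm
  obtain ⟨i, hi, hmi⟩ := h m (mem_support_iff.2 hm)
  refine ⟨i, ?_, hmi⟩
  rcases Nat.lt_succ_iff_lt_or_eq.1 hi with h1 | h1
  · exact h1
  · exfalso
    apply hle
    rw [Finsupp.single_le_iff, ← Fin.ext h1]
    exact Nat.one_le_iff_ne_zero.2 hmi

theorem coeff_zero_eq_zero_of_mem_span_X {K : Type*} [Field K] {n : ℕ}
    {p : MvPolynomial (Fin n) K} (h : p ∈ Ideal.span (Set.range X)) : coeff 0 p = 0 := by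
  rw [← initialVarIdeal_self, mem_initialVarIdeal] at h
  by_contra h0
  obtain ⟨i, -, hi⟩ := h 0 (mem_support_iff.2 h0)
  exact hi rfl

/-! ### Vectors with entries in an ideal -/

/-- The submodule `J R^r` of `R^r`, described as the vectors all of whose entries lie in `J`. -/
def vectorsIn {R : Type*} [CommRing R] (J : Ideal R) (r : ℕ) : Submodule R (Fin r → R) :=
  Submodule.pi Set.univ fun _ => J

theorem mem_vectorsIn {R : Type*} [CommRing R] {J : Ideal R} {r : ℕ} {v : Fin r → R} :
    v ∈ vectorsIn J r ↔ ∀ t, v t ∈ J := by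
  simp [vectorsIn]

theorem vectorsIn_mono {R : Type*} [CommRing R] {J J' : Ideal R} (h : J ≤ J') (r : ℕ) :
    vectorsIn J r ≤ vectorsIn J' r := fun _ hv =>
  mem_vectorsIn.2 fun t => h (mem_vectorsIn.1 hv t)

theorem map_mem_vectorsIn {R : Type*} [CommRing R] {J : Ideal R} {r s : ℕ}
    (φ : (Fin r → R) →ₗ[R] (Fin s → R)) {v : Fin r → R} (hv : v ∈ vectorsIn J r) :
    φ v ∈ vectorsIn J s := by
  rw [mem_vectorsIn] at hv ⊢
  intro t
  rw [LinearMap.pi_apply_eq_sum_univ φ v, Finset.sum_apply]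
  exact Ideal.sum_mem _ fun i _ => J.mul_mem_right _ (hv i)

theorem smul_mem_vectorsIn {R : Type*} [CommRing R] {J : Ideal R} {r : ℕ} {x : R} (hx : x ∈ J)
    (v : Fin r → R) : x • v ∈ vectorsIn J r :=
  mem_vectorsIn.2 fun t => J.mul_mem_right (v t) hx

theorem mem_vectorsIn_of_X_smul_mem {K : Type*} [Field K] {n r : ℕ} (k : Fin n)
    {v : Fin r → MvPolynomial (Fin n) K}
    (h : (X k : MvPolynomial (Fin n) K) • v ∈ vectorsIn (initialVarIdeal K n k) r) :
    v ∈ vectorsIn (initialVarIdeal K n k) r := by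
  rw [mem_vectorsIn] at h ⊢
  exact fun t => mem_initialVarIdeal_of_X_mul_mem k (h t)

theorem isHomogeneousVector_single {K : Type*} [Field K] {n r : ℕ} (a : Fin r → ℕ) (t : Fin r) :
    IsHomogeneousVector a (a t) (Pi.single t (1 : MvPolynomial (Fin n) K)) := by
  intro s m hm
  by_cases hst : s = t
  · subst hst
    rw [Pi.single_eq_same] at hm
    have h0 : m = 0 := by
      by_contra h0
      rw [mem_support_iff, coeff_one, if_neg (Ne.symm h0)] at hm
      exact hm rfl
    rw [h0, map_zero, zero_add]
  · rw [Pi.single_eq_of_ne hst] at hm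
    simp at hm

/-- A vector over `J_{k+1}` is a multiple of `x_k` modulo `J_k`; if it is homogeneous, so is the
quotient. -/
theorem exists_sub_X_smul_mem {K : Type*} [Field K] {n r : ℕ} (k : Fin n)
    {v : Fin r → MvPolynomial (Fin n) K} (h : v ∈ vectorsIn (initialVarIdeal K n (k + 1)) r) :
    ∃ u : Fin r → MvPolynomial (Fin n) K,
      v - (X k : MvPolynomial (Fin n) K) • u ∈ vectorsIn (initialVarIdeal K n k) r ∧
      ∀ (a : Fin r → ℕ) (m : ℕ), IsHomogeneousVector a (m + 1) v → IsHomogeneousVector a m u := by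
  rw [mem_vectorsIn] at h
  refine ⟨fun t => (v t).divMonomial (Finsupp.single k 1), ?_, ?_⟩
  · rw [mem_vectorsIn]
    exact fun t => sub_X_mul_divMonomial_mem k (h t)
  · intro a m hv t s hs
    have := hv t (Finsupp.single k 1 + s) (by
      rw [mem_support_iff] at hs ⊢
      rwa [coeff_divMonomial] at hs)
    rw [map_add, Finsupp.degree_single] at this
    omega

/-! ### Dividing by the variables along the resolution -/

theorem MinimalGradedFreeResolution.d_d {K : Type*} [Field K] {n : ℕ}
    {I : Ideal (MvPolynomial (Fin n) K)} (F : MinimalGradedFreeResolution I) (i : ℕ)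
    (v : Fin (F.rank (i + 1 + 1)) → MvPolynomial (Fin n) K) : F.d i (F.d (i + 1) v) = 0 := by
  have h : F.d (i + 1) v ∈ LinearMap.range (F.d (i + 1)) := ⟨v, rfl⟩
  rw [F.exact_succ] at h
  exact h

/-- If `d_j v ≡ x_k u` modulo `J_k`, then `u` is a cycle modulo `J_k`. -/
theorem d_mem_of_d_sub_X_smul_mem {K : Type*} [Field K] {n : ℕ}
    {I : Ideal (MvPolynomial (Fin n) K)} (F : MinimalGradedFreeResolution I) (k : Fin n) (j : ℕ)
    {v : Fin (F.rank (j + 1 + 1)) → MvPolynomial (Fin n) K}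
    {u : Fin (F.rank (j + 1)) → MvPolynomial (Fin n) K}
    (h : F.d (j + 1) v - (X k : MvPolynomial (Fin n) K) • u ∈
      vectorsIn (initialVarIdeal K n k) (F.rank (j + 1))) :
    F.d j u ∈ vectorsIn (initialVarIdeal K n k) (F.rank j) := by
  apply mem_vectorsIn_of_X_smul_mem k
  have h1 := map_mem_vectorsIn (F.d j) h
  rw [map_sub, F.d_d, map_smul, zero_sub] at h1
  exact neg_mem_iff.1 h1

/-- `Tor_{j+1}(R/I, R/J_k) = 0` for `k ≤ j`: the complex `F/J_k F` is exact at `F_{j+1}`. -/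
theorem mem_sup_range_of_d_mem {K : Type*} [Field K] {n : ℕ}
    {I : Ideal (MvPolynomial (Fin n) K)} (F : MinimalGradedFreeResolution I) (k : ℕ) (hk : k ≤ n) :
    ∀ (j : ℕ) (_ : k ≤ j) (z : Fin (F.rank (j + 1)) → MvPolynomial (Fin n) K),
      F.d j z ∈ vectorsIn (initialVarIdeal K n k) (F.rank j) →
      z ∈ vectorsIn (initialVarIdeal K n k) (F.rank (j + 1)) ⊔ LinearMap.range (F.d (j + 1)) := by
  induction k with
  | zero =>
    intro j _ z hz
    apply Submodule.mem_sup_right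
    rw [F.exact_succ, LinearMap.mem_ker]
    rw [initialVarIdeal_zero, mem_vectorsIn] at hz
    exact funext fun t => by simpa using hz t
  | succ k ih =>
    intro j hj z hz
    obtain ⟨j, rfl⟩ : ∃ i, j = i + 1 := ⟨j - 1, by omega⟩
    obtain ⟨u, hu, -⟩ := exists_sub_X_smul_mem (⟨k, hk⟩ : Fin n) hz
    have hdu := d_mem_of_d_sub_X_smul_mem F ⟨k, hk⟩ j hu
    obtain ⟨w, hw, _, ⟨v, rfl⟩, rfl⟩ :=
      Submodule.mem_sup.1 (ih (by omega) j (by omega) u hdu)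
    -- `z - x_k v` is a cycle modulo `J_k`, one step further up
    have hc : F.d (j + 1) (z - (X ⟨k, hk⟩ : MvPolynomial (Fin n) K) • v) ∈
        vectorsIn (initialVarIdeal K n k) (F.rank (j + 1)) := by
      have := add_mem hu (Submodule.smul_mem _ (X ⟨k, hk⟩ : MvPolynomial (Fin n) K) hw)
      convert this using 1
      rw [map_sub, map_smul, smul_add]
      abel
    have hz' := ih (by omega) (j + 1) (by omega) _ hc
    have hle := vectorsIn_mono (initialVarIdeal_mono K n (Nat.le_succ k)) (F.rank (j + 1 + 1))
    have h2 : (X ⟨k, hk⟩ : MvPolynomial (Fin n) K) • v ∈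
        vectorsIn (initialVarIdeal K n (k + 1)) (F.rank (j + 1 + 1)) :=
      smul_mem_vectorsIn (X_mem_initialVarIdeal _ (Nat.lt_succ_self k)) v
    have := add_mem (sup_le_sup_right hle _ hz') (Submodule.mem_sup_left h2)
    rwa [sub_add_cancel] at this

/-- `u ∈ F_k` represents a nonzero class of `Tor_0(F_k / im d_k, R/J_k)` which is homogeneous of
degree `m` and killed by all variables. -/
structure IsSocleVector {K : Type*} [Field K] {n : ℕ} {I : Ideal (MvPolynomial (Fin n) K)}
    (F : MinimalGradedFreeResolution I) (k m : ℕ) (u : Fin (F.rank k) → MvPolynomial (Fin n) K) :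
    Prop where
  homogeneous : IsHomogeneousVector (F.shift k) m u
  notMem : u ∉ vectorsIn (initialVarIdeal K n k) (F.rank k) ⊔ LinearMap.range (F.d k)
  X_smul_mem : ∀ i : Fin n, (X i : MvPolynomial (Fin n) K) • u ∈
    vectorsIn (initialVarIdeal K n k) (F.rank k) ⊔ LinearMap.range (F.d k)

/-- The connecting homomorphism `Tor_{k+1}(R/I, R/J_{k+1}) → Tor_k(R/I, R/J_k)`, on
representatives: it is linear and injective, and lowers degrees by one. -/
theorem IsSocleVector.descend {K : Type*} [Field K] {n : ℕ} {I : Ideal (MvPolynomial (Fin n) K)}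
    {F : MinimalGradedFreeResolution I} (k : Fin n) {m : ℕ}
    {u : Fin (F.rank (k + 1)) → MvPolynomial (Fin n) K} (hu : IsSocleVector F (k + 1) (m + 1) u)
    (hd : F.d k u ∈ vectorsIn (initialVarIdeal K n (k + 1)) (F.rank k)) :
    ∃ u' : Fin (F.rank k) → MvPolynomial (Fin n) K, IsSocleVector F k m u' ∧
      F.d k u - (X k : MvPolynomial (Fin n) K) • u' ∈
        vectorsIn (initialVarIdeal K n k) (F.rank k) := by
  obtain ⟨u', hu', hhom⟩ := exists_sub_X_smul_mem k hd
  refine ⟨u', ⟨hhom _ _ (F.d_homogeneous _ _ _ hu.homogeneous), ?_, ?_⟩, hu'⟩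
  · intro hmem
    apply hu.notMem
    obtain ⟨w, hw, _, ⟨v, rfl⟩, rfl⟩ := Submodule.mem_sup.1 hmem
    have hc : F.d k (u - (X k : MvPolynomial (Fin n) K) • v) ∈
        vectorsIn (initialVarIdeal K n k) (F.rank k) := by
      have := add_mem hu' (Submodule.smul_mem _ (X k : MvPolynomial (Fin n) K) hw)
      convert this using 1
      rw [map_sub, map_smul, smul_add]
      abel
    have hz := mem_sup_range_of_d_mem F k k.2.le k le_rfl _ hc
    have hle := vectorsIn_mono (initialVarIdeal_mono K n (Nat.le_succ k)) (F.rank (k + 1))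
    have h2 : (X k : MvPolynomial (Fin n) K) • v ∈
        vectorsIn (initialVarIdeal K n (k + 1)) (F.rank (k + 1)) :=
      smul_mem_vectorsIn (X_mem_initialVarIdeal _ (Nat.lt_succ_self k)) v
    have := add_mem (sup_le_sup_right hle _ hz) (Submodule.mem_sup_left h2)
    rwa [sub_add_cancel] at this
  · intro i
    obtain ⟨w, hw, _, ⟨y, rfl⟩, he⟩ := Submodule.mem_sup.1 (hu.X_smul_mem i)
    obtain ⟨v, hv, -⟩ := exists_sub_X_smul_mem k hw
    -- `x_i d u = d w ≡ x_k d v` modulo `J_k`, so `x_i u' ≡ d v` after cancelling `x_k`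
    have h1 : (X i : MvPolynomial (Fin n) K) • F.d k u = F.d k w := by
      rw [← map_smul, ← he, map_add, F.d_d, add_zero]
    have h2 : (X i : MvPolynomial (Fin n) K) • u' - F.d k v ∈
        vectorsIn (initialVarIdeal K n k) (F.rank k) := by
      apply mem_vectorsIn_of_X_smul_mem k
      have := sub_mem (map_mem_vectorsIn (F.d k) hv)
        (Submodule.smul_mem _ (X i : MvPolynomial (Fin n) K) hu')
      convert this using 1
      rw [map_sub, map_smul, smul_sub, smul_sub, h1, smul_comm]
      abel
    have := add_mem (Submodule.mem_sup_left h2)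
      (Submodule.mem_sup_right (LinearMap.mem_range_self (F.d k) v))
    rwa [sub_add_cancel] at this

/-- If `F_n` has a basis vector of degree `n + d`, then `F_0` has a vector of degree `d` whose
class in `R/I` is a nonzero socle element. -/
theorem exists_socle_vector {K : Type*} [Field K] {n : ℕ} {I : Ideal (MvPolynomial (Fin n) K)}
    (F : MinimalGradedFreeResolution I) (d : ℕ) (hn : 1 ≤ n) (t : Fin (F.rank n))
    (ht : F.shift n t = n + d) :
    ∃ u : Fin (F.rank 0) → MvPolynomial (Fin n) K, IsSocleVector F 0 d u := by
  have key : ∀ i k : ℕ, i + k + 1 = n → ∃ u : Fin (F.rank (k + 1)) → MvPolynomial (Fin n) K,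
      IsSocleVector F (k + 1) (d + k + 1) u ∧
        F.d k u ∈ vectorsIn (initialVarIdeal K n (k + 1)) (F.rank k) := by
    intro i
    induction i with
    | zero =>
      intro k hk
      have hk' : n = k + 1 := by omega
      have hJ : initialVarIdeal K n (k + 1) = Ideal.span (Set.range X) := by
        rw [← hk', initialVarIdeal_self]
      have hd : ∀ j v, F.d j v ∈ vectorsIn (initialVarIdeal K n (k + 1)) (F.rank j) := by
        intro j v
        rw [mem_vectorsIn, hJ]
        exact F.minimal j v
      obtain ⟨t, ht⟩ : ∃ t : Fin (F.rank (k + 1)), F.shift (k + 1) t = d + k + 1 := by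
        have : ∀ a, n = a → ∃ t : Fin (F.rank a), F.shift a t = n + d := by
          rintro a rfl
          exact ⟨t, ht⟩
        obtain ⟨t, ht⟩ := this _ hk'
        exact ⟨t, by omega⟩
      refine ⟨Pi.single t 1, ⟨?_, ?_, fun i => Submodule.mem_sup_left
        (smul_mem_vectorsIn (X_mem_initialVarIdeal i (by omega)) _)⟩, hd _ _⟩
      · rw [show d + k + 1 = F.shift (k + 1) t from ht.symm]
        exact isHomogeneousVector_single _ t
      · intro hmem
        have hle : vectorsIn (initialVarIdeal K n (k + 1)) (F.rank (k + 1)) ⊔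
            LinearMap.range (F.d (k + 1)) ≤
            vectorsIn (initialVarIdeal K n (k + 1)) (F.rank (k + 1)) :=
          sup_le le_rfl (by rintro _ ⟨v, rfl⟩; exact hd _ v)
        have h1 := mem_vectorsIn.1 (hle hmem) t
        rw [Pi.single_eq_same, hJ] at h1
        simpa using coeff_zero_eq_zero_of_mem_span_X h1
    | succ i ih =>
      intro k hk
      obtain ⟨u, hu, hd⟩ := ih (k + 1) (by omega)
      obtain ⟨u', hu', hX⟩ := hu.descend (⟨k + 1, by omega⟩ : Fin n) hd
      exact ⟨u', hu', d_mem_of_d_sub_X_smul_mem F (⟨k + 1, by omega⟩ : Fin n) k hX⟩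
  obtain ⟨u, hu, hd⟩ := key (n - 1) 0 (by omega)
  obtain ⟨u', hu', -⟩ := hu.descend (⟨0, by omega⟩ : Fin n) hd
  exact ⟨u', hu'⟩

/-! ### The socle form -/

theorem MinimalGradedFreeResolution.shift_ne_of_betti_eq_zero {K : Type*} [Field K] {n : ℕ}
    {I : Ideal (MvPolynomial (Fin n) K)} (F : MinimalGradedFreeResolution I) {i j : ℕ}
    (h : F.betti i j = 0) (t : Fin (F.rank i)) : F.shift i t ≠ j := fun ht => by
  have := Finset.card_eq_zero.1 h
  have hmem : t ∈ Finset.univ.filter fun t : Fin (F.rank i) => F.shift i t = j := by simp [ht]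
  rw [this] at hmem
  simp at hmem

/-- In degrees at most `d`, the module `F_0` of a resolution with a Koszul tail has a single basis
vector, and its image in `R/I` is a nonzero constant. -/
theorem exists_unit_basis_vector {K : Type*} [Field K] {n d : ℕ}
    {I : Ideal (MvPolynomial (Fin n) K)} (F : MinimalGradedFreeResolution I)
    (hF : HasKoszulTail n d F.bettiTable) :
    ∃ t₀ : Fin (F.rank 0), F.shift 0 t₀ = 0 ∧ (∀ t, t ≠ t₀ → d < F.shift 0 t) ∧
      ∃ c : K, c ≠ 0 ∧ F.aug (Pi.single t₀ 1) = Ideal.Quotient.mk I (C c) := by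
  have h00 : F.betti 0 0 = 1 := hF.row_zero_left
  obtain ⟨t₀, h0⟩ := Finset.card_eq_one.1 h00
  have hiff : ∀ t, F.shift 0 t = 0 ↔ t = t₀ := fun t => by
    have := Finset.ext_iff.1 h0 t
    simpa using this
  have ht₀ := (hiff t₀).2 rfl
  refine ⟨t₀, ht₀, ?_, ?_⟩
  · intro t ht
    by_contra hle
    have hpos : F.shift 0 t ≠ 0 := fun h => ht ((hiff t).1 h)
    have hB : F.bettiTable (F.shift 0 t) 0 = 0 := by
      rcases Nat.lt_or_ge (F.shift 0 t) d with h | h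
      · exact hF.row_mid _ (by omega) h 0 (Nat.zero_le _)
      · rw [show F.shift 0 t = d by omega]
        exact hF.row_last_left
    rw [MinimalGradedFreeResolution.bettiTable, zero_add] at hB
    exact F.shift_ne_of_betti_eq_zero hB t rfl
  · have hhom : IsHomogeneousVector (F.shift 0) 0
        (Pi.single t₀ (1 : MvPolynomial (Fin n) K)) := by
      have := isHomogeneousVector_single (K := K) (n := n) (F.shift 0) t₀
      rwa [ht₀] at this
    obtain ⟨p, hp, hpe⟩ := F.aug_homogeneous 0 _ hhom
    have hpc : p = C (coeff 0 p) := by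
      rw [← homogeneousComponent_zero]
      exact (homogeneousComponent_eq_self ((mem_homogeneousSubmodule 0 p).1 hp)).symm
    refine ⟨coeff 0 p, fun hc => ?_, by rw [← hpc, ← hpe]; rfl⟩
    -- a basis vector in the kernel of the augmentation contradicts minimality
    rw [hc, C_0] at hpc
    rw [hpc, map_zero] at hpe
    have : Pi.single t₀ 1 ∈ LinearMap.range (F.d 0) := by
      rw [F.exact_zero]
      exact hpe.symm
    obtain ⟨v, hv⟩ := this
    have h1 := coeff_zero_eq_zero_of_mem_span_X (F.minimal 0 v t₀)
    rw [hv, Pi.single_eq_same] at h1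
    simp at h1

theorem mk_C_mul_eq_zero_iff {K : Type*} [Field K] {n : ℕ} {I : Ideal (MvPolynomial (Fin n) K)}
    {c : K} (hc : c ≠ 0) (p : MvPolynomial (Fin n) K) :
    Ideal.Quotient.mk I p * Ideal.Quotient.mk I (C c) = 0 ↔ p ∈ I := by
  rw [← map_mul, Ideal.Quotient.eq_zero_iff_mem]
  exact Ideal.mul_unit_mem_iff_mem I ((isUnit_iff_ne_zero.2 hc).map C)

theorem aug_single {K : Type*} [Field K] {n : ℕ} {I : Ideal (MvPolynomial (Fin n) K)}
    (F : MinimalGradedFreeResolution I) {t₀ : Fin (F.rank 0)} {c : K}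
    (hc : F.aug (Pi.single t₀ 1) = Ideal.Quotient.mk I (C c)) (p : MvPolynomial (Fin n) K) :
    F.aug (Pi.single t₀ p) = Ideal.Quotient.mk I p * Ideal.Quotient.mk I (C c) := by
  have : (Pi.single t₀ p : Fin (F.rank 0) → MvPolynomial (Fin n) K) = p • Pi.single t₀ 1 := by
    rw [← Pi.single_smul, smul_eq_mul, mul_one]
  rw [this, map_smul, hc]
  rfl

/-- A Koszul tail produces a nonzero socle element of degree `d` in `R/I`. -/
theorem exists_socle_form {K : Type*} [Field K] {n d : ℕ} (hn : 1 ≤ n)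
    {I : Ideal (MvPolynomial (Fin n) K)} (F : MinimalGradedFreeResolution I)
    (hF : HasKoszulTail n d F.bettiTable) :
    ∃ f : MvPolynomial (Fin n) K, f.IsHomogeneous d ∧ f ∉ I ∧ ∀ i, X i * f ∈ I := by
  obtain ⟨t, ht⟩ : ∃ t : Fin (F.rank n), F.shift n t = n + d := by
    have h : F.betti n (n + d) = 1 := by
      have := hF.row_last n hn le_rfl
      rwa [Nat.choose_self] at this
    obtain ⟨t, h⟩ := Finset.card_pos.1 (show 0 < F.betti n (n + d) by omega)
    exact ⟨t, by simpa using h⟩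
  obtain ⟨u, hu⟩ := exists_socle_vector F d hn t ht
  obtain ⟨t₀, ht₀, hlt, c, hc, haug⟩ := exists_unit_basis_vector F hF
  have hue : u = Pi.single t₀ (u t₀) := by
    funext t
    by_cases h : t = t₀
    · subst h; simp
    · rw [Pi.single_eq_of_ne h, ← support_eq_empty, Finset.eq_empty_iff_forall_notMem]
      intro s hs
      have := hu.homogeneous t s hs
      have := hlt t h
      omega
  have hiff : ∀ p : MvPolynomial (Fin n) K, Pi.single t₀ p ∈
      vectorsIn (initialVarIdeal K n 0) (F.rank 0) ⊔ LinearMap.range (F.d 0) ↔ p ∈ I := by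
    intro p
    have hbot : vectorsIn (initialVarIdeal K n 0) (F.rank 0) = ⊥ := by
      rw [initialVarIdeal_zero, eq_bot_iff]
      intro v hv
      exact (Submodule.mem_bot _).2 (funext fun t => by simpa using mem_vectorsIn.1 hv t)
    rw [hbot, bot_sup_eq, F.exact_zero, LinearMap.mem_ker, aug_single F haug,
      mk_C_mul_eq_zero_iff hc]
  refine ⟨u t₀, fun s hs => ?_, fun hmem => ?_, fun i => ?_⟩
  · have := hu.homogeneous t₀ s (mem_support_iff.2 hs)
    rw [ht₀, add_zero, Finsupp.degree_eq_weight_one] at this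
    exact this
  · apply hu.notMem
    rw [hue]
    exact (hiff _).2 hmem
  · have := hu.X_smul_mem i
    rw [hue, ← Pi.single_smul] at this
    exact (hiff _).1 this

/-! ### The degree `d + 1` part of the ideal -/

theorem homogeneousComponent_mul_of_le {K : Type*} [Field K] {n m e : ℕ}
    {h : MvPolynomial (Fin n) K} (hh : h.IsHomogeneous e) (hme : m ≤ e)
    (p : MvPolynomial (Fin n) K) :
    homogeneousComponent m (p * h) = if e = m then coeff 0 p • h else 0 := by
  have key : homogeneousComponent m (p * h) =
      (DirectSum.decompose (homogeneousSubmodule (Fin n) K) (p * h) m : MvPolynomial (Fin n) K) :=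
    (decomposition.decompose'_apply (p * h) m).symm
  rw [key]
  split_ifs with hem
  · subst hem
    rw [DirectSum.coe_decompose_mul_of_right_mem_of_le (homogeneousSubmodule (Fin n) K)
      ((mem_homogeneousSubmodule _ _).2 hh) le_rfl, Nat.sub_self, smul_eq_C_mul,
      ← homogeneousComponent_zero]
    congr 1
    exact decomposition.decompose'_apply p 0
  · exact DirectSum.coe_decompose_mul_of_right_mem_of_not_le (homogeneousSubmodule (Fin n) K)
      ((mem_homogeneousSubmodule _ _).2 hh) (by omega)

/-- The forms of degree `d + 1` in `I` lie in a space of dimension at most `β_{1,d+1} = n`. -/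
theorem exists_finset_span {K : Type*} [Field K] {n d : ℕ} (hn : 1 ≤ n)
    {I : Ideal (MvPolynomial (Fin n) K)} (F : MinimalGradedFreeResolution I)
    (hF : HasKoszulTail n d F.bettiTable) :
    ∃ S : Finset (MvPolynomial (Fin n) K), S.card ≤ n ∧
      ∀ g ∈ I, g.IsHomogeneous (d + 1) →
        g ∈ Submodule.span K (S : Set (MvPolynomial (Fin n) K)) := by
  classical
  obtain ⟨t₀, ht₀, -, c, hc, haug⟩ := exists_unit_basis_vector F hF
  let h : Fin (F.rank 1) → MvPolynomial (Fin n) K := fun t => F.d 0 (Pi.single t 1) t₀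
  have hh : ∀ t, (h t).IsHomogeneous (F.shift 1 t) := by
    intro t
    have hv : IsHomogeneousVector (F.shift (0 + 1)) (F.shift 1 t)
        (Pi.single t (1 : MvPolynomial (Fin n) K)) := isHomogeneousVector_single _ t
    intro s hs
    have := F.d_homogeneous 0 _ _ hv t₀ s (mem_support_iff.2 hs)
    rw [ht₀, add_zero, Finsupp.degree_eq_weight_one] at this
    exact this
  have h_zero : ∀ t, F.shift 1 t = 0 → h t = 0 := by
    intro t ht
    have h1 := hh t
    rw [ht] at h1
    rw [← homogeneousComponent_eq_self h1, homogeneousComponent_zero,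
      coeff_zero_eq_zero_of_mem_span_X (F.minimal 0 _ t₀), C_0]
  have h_shift : ∀ t, F.shift 1 t ≠ 0 → d + 1 ≤ F.shift 1 t := by
    intro t ht
    by_contra hlt
    obtain ⟨j, hj⟩ : ∃ j, F.shift 1 t = 1 + j := ⟨F.shift 1 t - 1, by omega⟩
    have hB : F.bettiTable j 1 = 0 := by
      rcases Nat.eq_zero_or_pos j with h | h
      · subst h
        exact hF.row_zero 1 le_rfl hn
      · exact hF.row_mid j h (by omega) 1 hn
    exact F.shift_ne_of_betti_eq_zero hB t hj
  refine ⟨(Finset.univ.filter fun t : Fin (F.rank 1) => F.shift 1 t = 1 + d).image h, ?_, ?_⟩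
  · refine Finset.card_image_le.trans (le_of_eq ?_)
    have := hF.row_last 1 le_rfl hn
    rwa [Nat.choose_one_right] at this
  · intro g hg hgd
    have hgr : Pi.single t₀ g ∈ LinearMap.range (F.d 0) := by
      rw [F.exact_zero, LinearMap.mem_ker, aug_single F haug]
      exact (mk_C_mul_eq_zero_iff hc g).2 hg
    obtain ⟨v, hv⟩ := hgr
    have hsum : g = ∑ t, v t * h t := by
      have h1 := congrFun (LinearMap.pi_apply_eq_sum_univ (F.d 0) v) t₀
      rw [hv, Pi.single_eq_same, Finset.sum_apply] at h1
      rw [h1]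
      refine Finset.sum_congr rfl fun t _ => ?_
      rw [Pi.smul_apply, smul_eq_mul]
      congr 1
      refine congrArg (fun w => F.d 0 w t₀) (funext fun s => ?_)
      simp [Pi.single_apply, eq_comm]
    -- compare the components of degree `d + 1` in `g = ∑ v_t h_t`
    rw [← homogeneousComponent_eq_self hgd, hsum, map_sum]
    refine Submodule.sum_mem _ fun t _ => ?_
    by_cases ht : F.shift 1 t = 0
    · rw [h_zero t ht, mul_zero, map_zero]
      exact Submodule.zero_mem _
    · rw [homogeneousComponent_mul_of_le (hh t) (h_shift t ht)]
      split_ifs with he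
      · refine Submodule.smul_mem _ _ (Submodule.subset_span ?_)
        rw [Finset.coe_image]
        exact ⟨t, by simp [he, add_comm], rfl⟩
      · exact Submodule.zero_mem _

/-- Multiplication by `f` on linear forms, in terms of their coefficients. -/
noncomputable def mulLinearFormMap {K : Type*} [Field K] {n : ℕ} (f : MvPolynomial (Fin n) K) :
    (Fin n → K) →ₗ[K] MvPolynomial (Fin n) K :=
  LinearMap.mulLeft K f ∘ₗ Fintype.linearCombination K X

theorem mulLinearFormMap_apply {K : Type*} [Field K] {n : ℕ} (f : MvPolynomial (Fin n) K)
    (a : Fin n → K) : mulLinearFormMap f a = f * linearForm a := by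
  simp [mulLinearFormMap, Fintype.linearCombination_apply, linearForm, smul_eq_C_mul,
    Finset.mul_sum]

theorem coeff_linearForm {K : Type*} [Field K] {n : ℕ} (a : Fin n → K) (i : Fin n) :
    coeff (Finsupp.single i 1) (linearForm a) = a i := by
  classical
  simp [linearForm, coeff_sum, coeff_C_mul, coeff_X, Finsupp.single_left_inj]

theorem mulLinearFormMap_injective {K : Type*} [Field K] {n : ℕ} {f : MvPolynomial (Fin n) K}
    (hf : f ≠ 0) : Function.Injective (mulLinearFormMap f) := by
  intro a b hab
  rw [mulLinearFormMap_apply, mulLinearFormMap_apply] at hab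
  have h := mul_left_cancel₀ hf hab
  funext i
  rw [← coeff_linearForm a, h, coeff_linearForm]

theorem mem_of_homogeneous_iff {K : Type*} [Field K] {n d : ℕ} (hn : 1 ≤ n)
    {I : Ideal (MvPolynomial (Fin n) K)} (F : MinimalGradedFreeResolution I)
    (hF : HasKoszulTail n d F.bettiTable) {f : MvPolynomial (Fin n) K} (hfd : f.IsHomogeneous d)
    (hfI : f ∉ I) (hX : ∀ i, X i * f ∈ I) (g : MvPolynomial (Fin n) K) :
    (g ∈ I ∧ g.IsHomogeneous (d + 1)) ↔ ∃ a : Fin n → K, g = f * linearForm a := by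
  have hback : ∀ a : Fin n → K, f * linearForm a ∈ I ∧ (f * linearForm a).IsHomogeneous (d + 1) := by
    intro a
    refine ⟨?_, hfd.mul (linearForm_isHomogeneous a)⟩
    rw [linearForm, Finset.mul_sum]
    refine Ideal.sum_mem _ fun t _ => ?_
    rw [mul_left_comm, mul_comm f]
    exact I.mul_mem_left _ (hX t)
  refine ⟨?_, by rintro ⟨a, rfl⟩; exact hback a⟩
  rintro ⟨hg, hgd⟩
  obtain ⟨S, hS, hspan⟩ := exists_finset_span hn F hF
  have hf : f ≠ 0 := fun h => hfI (h ▸ I.zero_mem)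
  have hle : LinearMap.range (mulLinearFormMap f) ≤
      Submodule.span K (S : Set (MvPolynomial (Fin n) K)) := by
    rintro _ ⟨a, rfl⟩
    rw [mulLinearFormMap_apply]
    exact hspan _ (hback a).1 (hback a).2
  have heq := Submodule.eq_of_le_of_finrank_le hle (by
    rw [LinearMap.finrank_range_of_inj (mulLinearFormMap_injective hf), Module.finrank_fin_fun]
    exact (finrank_span_finset_le_card S).trans hS)
  have hmem := hspan g hg hgd
  rw [← heq] at hmem
  obtain ⟨a, ha⟩ := hmem
  exact ⟨a, by rw [← ha, mulLinearFormMap_apply]⟩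

/-! ### Failure of surjectivity -/

/-- A linear change of variables that kills the linear form with coefficients `a` and fixes all
variables but one. -/
theorem exists_algHom_linearForm_eq_zero {K : Type*} [Field K] {n : ℕ} (hn : 1 ≤ n)
    (a : Fin n → K) :
    ∃ (k : Fin n) (φ : MvPolynomial (Fin n) K →ₐ[K] MvPolynomial (Fin n) K),
      φ (linearForm a) = 0 ∧ (∀ i, i ≠ k → φ (X i) = X i) ∧
        ∀ (p : MvPolynomial (Fin n) K) (m : ℕ), p.IsHomogeneous m → (φ p).IsHomogeneous m := by
  obtain ⟨k, hk⟩ : ∃ k : Fin n, a k = 0 → a = 0 := by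
    by_cases h : a = 0
    · exact ⟨⟨0, hn⟩, fun _ => h⟩
    · obtain ⟨k, hk⟩ := Function.ne_iff.1 h
      exact ⟨k, fun h0 => absurd h0 hk⟩
  let b : Fin n → Fin n → K := fun i s =>
    if i = k then (if s = k then 0 else -(a k)⁻¹ * a s) else if s = i then 1 else 0
  refine ⟨k, aeval fun i => linearForm (b i), ?_, ?_, ?_⟩
  · by_cases h0 : a = 0
    · subst h0
      simp [linearForm]
    have hak : a k ≠ 0 := fun h => h0 (hk h)
    have h1 : (aeval fun i => linearForm (b i)) (linearForm a) =
        linearForm fun s => ∑ i, a i * b i s := by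
      simp only [linearForm, map_sum, map_mul, aeval_X, algHom_C, algebraMap_eq, Finset.mul_sum,
        Finset.sum_mul]
      rw [Finset.sum_comm]
      refine Finset.sum_congr rfl fun s _ => Finset.sum_congr rfl fun i _ => ?_
      ring
    have h2 : (fun s => ∑ i, a i * b i s) = 0 := by
      funext s
      rw [Pi.zero_apply, ← Finset.add_sum_erase _ _ (Finset.mem_univ k)]
      have h3 : ∑ i ∈ Finset.univ.erase k, a i * b i s = if s = k then 0 else a s := by
        have : ∀ i ∈ Finset.univ.erase k, a i * b i s = if s = i then a i else 0 := by
          intro i hi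
          simp [b, Finset.ne_of_mem_erase hi]
        rw [Finset.sum_congr rfl this, Finset.sum_ite_eq]
        by_cases hs : s = k <;> simp [hs]
      rw [h3]
      by_cases hs : s = k
      · simp [b, hs]
      · simp [b, hs, hak]
    rw [h1, h2]
    simp [linearForm]
  · intro i hi
    rw [aeval_X]
    simp [linearForm, b, hi]
  · intro p m hp
    have := hp.aeval (fun i => linearForm (b i)) (n := 1) fun i => linearForm_isHomogeneous _
    rwa [one_mul] at this

theorem isUnit_of_dvd_X_pow {K : Type*} [Field K] {n : ℕ} {i j : Fin n} (hij : i ≠ j) {m : ℕ}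
    {p : MvPolynomial (Fin n) K} (hi : p ∣ X i ^ m) (hj : p ∣ X j ^ m) : IsUnit p := by
  have hrel : IsRelPrime (X i : MvPolynomial (Fin n) K) (X j) :=
    (X_prime (R := K) (i := i)).irreducible.isRelPrime_iff_not_dvd.2 fun h => hij (X_dvd_X.1 h)
  exact hrel.pow hi hj

/-- For a form `f` of positive degree, `l R + f R` misses `x_i^{d+1}` for some `i`. Three variables
are needed, so that two of them survive modulo `l`. -/
theorem exists_X_pow_ne {K : Type*} [Field K] {n d : ℕ} (hn : 3 ≤ n) (hd : 1 ≤ d)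
    {f : MvPolynomial (Fin n) K} (hf : f.IsHomogeneous d) (a : Fin n → K) :
    ∃ i : Fin n, ∀ p q : MvPolynomial (Fin n) K,
      X i ^ (d + 1) ≠ linearForm a * p + f * q := by
  by_contra! hall
  obtain ⟨k, φ, hφ, hfix, hhom⟩ := exists_algHom_linearForm_eq_zero (by omega) a
  obtain ⟨i, hi, j, hj, hij⟩ : ∃ i, i ≠ k ∧ ∃ j, j ≠ k ∧ i ≠ j := by
    have hcard : 1 < (Finset.univ.erase k).card := by
      rw [Finset.card_erase_of_mem (Finset.mem_univ k), Finset.card_univ, Fintype.card_fin]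
      omega
    obtain ⟨i, hi, j, hj, hij⟩ := Finset.one_lt_card.1 hcard
    exact ⟨i, Finset.ne_of_mem_erase hi, j, Finset.ne_of_mem_erase hj, hij⟩
  have hdvd : ∀ i, i ≠ k → φ f ∣ X i ^ (d + 1) := by
    intro i hi
    obtain ⟨p, q, h⟩ := hall i
    have := congrArg φ h
    rw [map_pow, hfix i hi, map_add, map_mul, map_mul, hφ, zero_mul, zero_add] at this
    exact ⟨φ q, this⟩
  have hunit : IsUnit (constantCoeff (φ f)) :=
    (isUnit_of_dvd_X_pow hij (hdvd i hi) (hdvd j hj)).map constantCoeff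
  have h0 : constantCoeff (φ f) = 0 := by
    rw [constantCoeff_eq]
    exact (hhom f d hf).coeff_eq_zero (by rw [map_zero]; omega)
  rw [h0] at hunit
  exact not_isUnit_zero hunit

/-! ### Conclusion -/

theorem theorem2 {K : Type*} [Field K] (n d : ℕ) (hn : 3 ≤ n)
    (I : Ideal (MvPolynomial (Fin n) K))
    (hI : I.IsHomogeneous (MvPolynomial.homogeneousSubmodule (Fin n) K))
    (hA : IsArtinianRing (MvPolynomial (Fin n) K ⧸ I))
    (F : MinimalGradedFreeResolution I)
    (hF : HasKoszulTail n d F.bettiTable) :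
    ¬ HasWLP I ∧
      (∀ a : Fin n → K, ¬ IsFullRank (mulLinearForm I a d)) ∧
      ∃ f : MvPolynomial (Fin n) K, f.IsHomogeneous d ∧
        ∀ g : MvPolynomial (Fin n) K,
          (g ∈ I ∧ g.IsHomogeneous (d + 1)) ↔ ∃ a : Fin n → K, g = f * linearForm a := by
  obtain ⟨f, hfd, hfI, hX⟩ := exists_socle_form (by omega) F hF
  have hiff := mem_of_homogeneous_iff (by omega) F hF hfd hfI hX
  have hrank : ∀ a : Fin n → K, ¬ IsFullRank (mulLinearForm I a d) := by
    rintro a (hinj | hsurj)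
    · have hmem : Ideal.Quotient.mk I f ∈ gradedPiece I d :=
        ⟨f, (mem_homogeneousSubmodule d f).2 hfd, rfl⟩
      have hzero : mulLinearForm I a d ⟨Ideal.Quotient.mk I f, hmem⟩ = 0 := by
        apply Subtype.ext
        change Ideal.Quotient.mk I (linearForm a) * Ideal.Quotient.mk I f = 0
        rw [← map_mul, Ideal.Quotient.eq_zero_iff_mem, mul_comm]
        exact ((hiff _).2 ⟨a, rfl⟩).1
      have h0 := hinj (hzero.trans (map_zero _).symm)
      exact hfI (Ideal.Quotient.eq_zero_iff_mem.1 (congrArg Subtype.val h0))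
    · obtain ⟨i, hi⟩ := exists_X_pow_ne hn hF.pos hfd a
      have hpow : (X i ^ (d + 1) : MvPolynomial (Fin n) K).IsHomogeneous (d + 1) :=
        isHomogeneous_X_pow i (d + 1)
      obtain ⟨⟨_, p, hp, rfl⟩, hy⟩ := hsurj ⟨Ideal.Quotient.mk I (X i ^ (d + 1)),
        ⟨X i ^ (d + 1), (mem_homogeneousSubmodule _ _).2 hpow, rfl⟩⟩
      have hy' : Ideal.Quotient.mk I (linearForm a * p) = Ideal.Quotient.mk I (X i ^ (d + 1)) := by
        rw [map_mul]
        exact congrArg Subtype.val hy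
      have hlp : (linearForm a * p).IsHomogeneous (d + 1) := by
        rw [add_comm]
        exact (linearForm_isHomogeneous a).mul ((mem_homogeneousSubmodule d p).1 hp)
      obtain ⟨b, hb⟩ := (hiff (X i ^ (d + 1) - linearForm a * p)).1
        ⟨Ideal.Quotient.eq.1 hy'.symm, hpow.sub hlp⟩
      exact hi p (linearForm b) (by rw [← hb]; ring)
  refine ⟨?_, hrank, f, hfd, hiff⟩
  rintro ⟨P, ⟨a, ha⟩, hQ⟩
  exact hrank a (hQ a ha d)
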